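/- Let $\mathcal H$ be a separable complex Hilbert space and let $\mathbf A=(A_1,\dots,A_n)$ be an $n$-tuple of pairwise commuting bounded self-adjoint operators on $\mathcal H$. For a measure space $(X,\mu)$ and a measurable function $a:X\to\mathbb R$, $M_a$ denotes multiplication by $a$ on $L^2(X,\mu)$ (complex-valued functions): $(M_af)(x)=a(x)f(x)$ for almost every $x$; whenever $M_a$ appears below, it is part of the claim that it is defined on all of $L^2(X,\mu)$. Let $x_k:\mathbb R^n\to\mathbb R$ be the $k$-th coordinate function. (1) Suppose that $\mathbf A$ has a joint cyclic vector, i.e. a vector $\xi$ such that $\{p(A_1,\dots,A_n)\xi : p\in\mathbb C[t_1,\dots,t_n]\}$ is dense in $\mathcal H$. Then there exist a finite Borel measure $\mu$ on $X=\mathbb R^n$ and a unitary operator $U:L^2(X,\mu)\to\mathcal H$ such that $$U^{-1}A_kU=M_{x_k},\qquad k=1,\dots,n.$$ (2) In general (without a cyclic vector), let $\mathcal A=C^*(A_1,\dots,A_n)$ be the unital C*-algebra generated by $A_1,\dots,A_n$. There exist a set $I\subseteq\mathbb N$ and, for $m\in I$, nonzero closed subspaces $H_m\subseteq\mathcal H$,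 vectors $\xi_m\in H_m$, finite Borel measures $\mu_m$ on $\mathbb R^n$ and unitary operators $U_m:L^2(\mathbb R^n,\mu_m)\to H_m$ such that: (a) the $H_m$ are pairwise orthogonal with $\mathcal H=\bigoplus_{m\in I}H_m$ (Hilbert sum), each $H_m$ is reducing for every operator in $\mathcal A$, and $H_m=\overline{\mathcal A\xi_m}$; (b) $U_m^{-1}(A_k|_{H_m})U_m=M_{x_k}$ on $L^2(\mathbb R^n,\mu_m)$ for all $m\in I$ and $k=1,\dots,n$; (c) $V\big((f_m)_{m\in I}\big):=\sum_{m\in I}U_mf_m$ defines a unitary operator $V:\bigoplus_{m\in I}L^2(\mathbb R^n,\mu_m)\to\mathcal H$, and $V^{-1}A_kV=\bigoplus_{m\in I}M_{x_k}$ for $k=1,\dots,n$; (d) if $\mu$ is the measure on $X=I\times\mathbb R^n$ given by $\mu(B)=\sum_{m\in I}\mu_m(\{x\in\mathbb R^n:(m,x)\in B\})$, then $\Phi\big((f_m)_{m\in I}\big)(m,x):=f_m(x)$ defines a unitary operator $\Phi:\bigoplus_{m\in I}L^2(\mathbb R^n,\mu_m)\to L^2(X,\mu)$, and $U:=V\circ\Phi^{-1}:L^2(X,\mu)\to\mathcal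 H$ is a unitary operator such that $$U^{-1}A_kU=M_{a_k},\qquad a_k(m,x)=x_k,\qquad k=1,\dots,n.$$ -/

import Mathlib

open MeasureTheory
open scoped ENNReal InnerProductSpace

/-- `ξ` is a joint cyclic vector of the commuting tuple `A`: the vectors `p(A₁, …, Aₙ) ξ`, with `p`
a complex polynomial, are dense. The operators `p(A₁, …, Aₙ)` are exactly the elements of the
unital subalgebra generated by the `A k`. -/
def IsJointCyclicVector {H : Type*} [NormedAddCommGroup H] [InnerProductSpace ℂ H]
    {n : ℕ} (A : Fin n → H →L[ℂ] H) (ξ : H) : Prop :=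
  Dense {x : H | ∃ T ∈ Algebra.adjoin ℂ (Set.range A), T ξ = x}

/-- The (unital) C⋆-algebra `C*(A₁, …, Aₙ)` of operators generated by the tuple `A`. -/
noncomputable def tupleCStarAlgebra {H : Type*} [NormedAddCommGroup H] [InnerProductSpace ℂ H]
    [CompleteSpace H] {n : ℕ} (A : Fin n → H →L[ℂ] H) : StarSubalgebra ℂ (H →L[ℂ] H) :=
  (StarAlgebra.adjoin ℂ (Set.range A)).topologicalClosure

/-- The subspace `K` reduces the operator `T`: `K` and its orthogonal complement are invariant. -/
def IsReducingFor {H : Type*} [NormedAddCommGroup H] [InnerProductSpace ℂ H]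
    (K : Submodule ℂ H) (T : H →L[ℂ] H) : Prop :=
  (∀ x ∈ K, T x ∈ K) ∧ ∀ x ∈ Kᗮ, T x ∈ Kᗮ

/-- `T` is the multiplication operator `M_a` on `L²(X, μ)`: it is defined on all of `L²(X, μ)` and
`(T f)(x) = a(x) f(x)` for almost every `x`. -/
def IsMultiplicationOp {X : Type*} [MeasurableSpace X] (μ : Measure X) (a : X → ℝ)
    (T : Lp ℂ 2 μ → Lp ℂ 2 μ) : Prop :=
  ∀ f : Lp ℂ 2 μ, ∀ᵐ x ∂μ, (T f : X → ℂ) x = (a x : ℂ) * (f : X → ℂ) x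

/-- The disjoint union of a family of measures on `X`: the measure on `ι × X` whose restriction to
the slice `{i} × X` is `μ i`. -/
noncomputable def disjointUnionMeasure {ι X : Type*} [MeasurableSpace ι] [MeasurableSpace X]
    (μ : ι → Measure X) : Measure (ι × X) :=
  Measure.sum fun i => (μ i).map (Prod.mk i)

open scoped BoundedContinuousFunction CompactlySupported

/-! ### Gelfand duality and spectral measures of vectors. -/

section FunctionalCalculus

universe u

variable {H : Type u} [NormedAddCommGroup H] [InnerProductSpace ℂ H] [CompleteSpace H]

/-! The generated C⋆-algebra is commutative, so by Gelfand duality it is `C(X, ℂ)` for a compact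
`X`, and the self-adjoint `A k` become the components of a continuous map `j : X → ℝⁿ`. For a vector
`ξ`, the functional `f ↦ ⟪ξ, S f ξ⟫` is positive; Riesz–Markov–Kakutani yields a measure `ν` with `∫
‖f‖² dν = ‖S f ξ‖²`. After pushing `ν` forward along `j` to `μ`, the map `f ↦ S f ξ` is isometric
from the bounded continuous functions, dense in `L²(μ)`, to `H`. It extends to an isometry onto the
closed cyclic subspace of `ξ`, and multiplicativity of `S` turns `A k` into multiplication by `x k`
(`exists_linearIsometry_cyclic`).

Without a cyclic vector, a Gram–Schmidt procedure on a dense sequence splits `H` into countably many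
orthogonal cyclic subspaces (`exists_orthogonal_tupleCyclicSubspaces`). Their models are glued as a
Hilbert sum, which is `L²` of the disjoint union of the measures (`exists_lp_equiv_disjointUnion`).
-/

theorem commute_of_mem_tupleCStarAlgebra {n : ℕ} {A : Fin n → H →L[ℂ] H}
    (hsa : ∀ k, IsSelfAdjoint (A k)) (hcomm : ∀ j k, Commute (A j) (A k))
    (S T : tupleCStarAlgebra A) : S * T = T * S := by
  have h : IsMulCommutative (StarAlgebra.adjoin ℂ (Set.range A)) := by
    refine StarAlgebra.isMulCommutative_adjoin ℂ ?_ ?_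
    · rintro _ ⟨j, rfl⟩ _ ⟨k, rfl⟩
      exact hcomm j k
    · rintro _ ⟨j, rfl⟩ _ ⟨k, rfl⟩
      rw [(hsa k).star_eq]
      exact hcomm j k
  exact ((StarAlgebra.adjoin ℂ (Set.range A)).commRingTopologicalClosure
    fun x y => Subtype.ext (setLike_mul_comm x.2 y.2)).mul_comm S T

theorem isClosed_tupleCStarAlgebra {n : ℕ} (A : Fin n → H →L[ℂ] H) :
    IsClosed (tupleCStarAlgebra A : Set (H →L[ℂ] H)) :=
  StarSubalgebra.isClosed_topologicalClosure _

theorem mem_tupleCStarAlgebra {n : ℕ} (A : Fin n → H →L[ℂ] H) (k : Fin n) :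
    A k ∈ tupleCStarAlgebra A :=
  StarSubalgebra.le_topologicalClosure _ (StarAlgebra.subset_adjoin ℂ _ ⟨k, rfl⟩)

/-- A commuting tuple of self-adjoint operators has a continuous functional calculus on some compact
space, in which the operators are given by real coordinate functions. -/
theorem exists_jointFunctionalCalculus {n : ℕ} {A : Fin n → H →L[ℂ] H}
    (hsa : ∀ k, IsSelfAdjoint (A k)) (hcomm : ∀ j k, Commute (A j) (A k)) :
    ∃ (X : Type u) (_ : TopologicalSpace X) (_ : CompactSpace X) (_ : T2Space X)
      (S : C(X, ℂ) →⋆ₐ[ℂ] (H →L[ℂ] H)) (j : C(X, Fin n → ℝ)),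
      (∀ f, S f ∈ tupleCStarAlgebra A) ∧
        ∀ k, S ⟨fun x => (j x k : ℂ), by fun_prop⟩ = A k := by
  have hcl := isClosed_tupleCStarAlgebra A
  let _ : CommCStarAlgebra (tupleCStarAlgebra A) :=
    { StarSubalgebra.cstarAlgebra (tupleCStarAlgebra A) with
      mul_comm := commute_of_mem_tupleCStarAlgebra hsa hcomm }
  let a : Fin n → tupleCStarAlgebra A := fun k => ⟨A k, mem_tupleCStarAlgebra A k⟩
  have ha : ∀ k, IsSelfAdjoint (a k) := fun k => Subtype.ext (hsa k)
  let G := gelfandStarTransform (tupleCStarAlgebra A)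
  refine ⟨WeakDual.characterSpace ℂ (tupleCStarAlgebra A), inferInstance, inferInstance,
    inferInstance, (tupleCStarAlgebra A).subtype.comp (G.symm : _ →⋆ₐ[ℂ] _),
    ⟨fun x k => (G (a k) x).re, by fun_prop⟩, fun f => (G.symm f).2, fun k => ?_⟩
  -- The Gelfand transform of a self-adjoint element is real-valued, so taking real parts loses
  -- nothing.
  have : (⟨fun x => ((G (a k) x).re : ℂ), by fun_prop⟩ : C(_, ℂ)) = G (a k) := by
    ext x
    have h : star (G (a k)) = G (a k) := by rw [← map_star, (ha k).star_eq]
    exact Complex.conj_eq_iff_re.1 (congrArg (fun f => f x) h)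
  change ((G.symm (⟨fun x => ((G (a k) x).re : ℂ), _⟩ : C(_, ℂ)) : tupleCStarAlgebra A) :
    H →L[ℂ] H) = A k
  rw [this, StarAlgEquiv.symm_apply_apply]

/-- The spectral measure of a vector with respect to a representation of `C(X, ℂ)`. -/
theorem exists_spectralMeasure {X : Type*} [TopologicalSpace X] [CompactSpace X] [T2Space X]
    [MeasurableSpace X] [BorelSpace X] (S : C(X, ℂ) →⋆ₐ[ℂ] (H →L[ℂ] H)) (ξ : H) :
    ∃ ν : Measure X, IsFiniteMeasure ν ∧ ∀ f : C(X, ℂ), ∫ x, ‖f x‖ ^ 2 ∂ν = ‖S f ξ‖ ^ 2 := by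
  let c : C_c(X, ℝ) → C(X, ℂ) := fun f => ⟨fun x => (f x : ℂ), by fun_prop⟩
  -- `S (star f * f) = (S f)⋆ (S f)`. This gives both the positivity of the functional and the final
  -- norm identity.
  have key : ∀ f : C(X, ℂ), ⟪ξ, S (star f * f) ξ⟫_ℂ = (‖S f ξ‖ : ℂ) ^ 2 := fun f => by
    rw [map_mul, map_star, mul_apply_eq_comp, ContinuousLinearMap.star_eq_adjoint,
      ContinuousLinearMap.adjoint_inner_right, inner_self_eq_norm_sq_to_K]
    rfl
  let L : C_c(X, ℝ) →ₗ[ℝ] ℝ :=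
    { toFun := fun f => (⟪ξ, S (c f) ξ⟫_ℂ).re
      map_add' := fun f g => by
        have : c (f + g) = c f + c g := by ext; simp [c]
        rw [this, map_add, add_apply, inner_add_right, Complex.add_re]
      map_smul' := fun r f => by
        have : c (r • f) = (r : ℂ) • c f := by ext; simp [c]
        rw [this, map_smul, smul_apply, inner_smul_right]
        simp }
  let Λ : C_c(X, ℝ) →ₚ[ℝ] ℝ := PositiveLinearMap.mk₀ L fun f hf => by
    -- A nonnegative `f` is `star √f * √f`, so `key` applies.
    have : c f = star (⟨fun x => (Real.sqrt (f x) : ℂ), by fun_prop⟩ : C(X, ℂ)) *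
        ⟨fun x => (Real.sqrt (f x) : ℂ), by fun_prop⟩ := by
      ext x
      have hx : (0 : ℝ) ≤ f x := hf x
      simp only [c, ContinuousMap.coe_mk, ContinuousMap.mul_apply, ContinuousMap.star_apply,
        RCLike.star_def, Complex.conj_ofReal]
      rw [← Complex.ofReal_mul, Real.mul_self_sqrt hx]
    change 0 ≤ (⟪ξ, S (c f) ξ⟫_ℂ).re
    rw [this, key, ← Complex.ofReal_pow, Complex.ofReal_re]
    positivity
  refine ⟨RealRMK.rieszMeasure Λ, inferInstance, fun f => ?_⟩
  let g : C_c(X, ℝ) := ⟨⟨fun x => ‖f x‖ ^ 2, by fun_prop⟩, HasCompactSupport.of_compactSpace _⟩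
  have hg : c g = star f * f := by
    ext x
    simp [c, g, ← Complex.normSq_eq_conj_mul_self, Complex.normSq_eq_norm_sq]
  refine (RealRMK.integral_rieszMeasure Λ g).trans ?_
  change (⟪ξ, S (c g) ξ⟫_ℂ).re = _
  rw [hg, key, ← Complex.ofReal_pow, Complex.ofReal_re]

theorem norm_toLp_two_sq {X : Type*} [TopologicalSpace X] [MeasurableSpace X] [BorelSpace X]
    [SecondCountableTopology X] (μ : Measure X) [IsFiniteMeasure μ] (f : X →ᵇ ℂ) :
    ‖BoundedContinuousFunction.toLp 2 μ ℂ f‖ ^ 2 = ∫ x, ‖f x‖ ^ 2 ∂μ := by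
  have h := L2.inner_def (𝕜 := ℂ) (BoundedContinuousFunction.toLp 2 μ ℂ f)
    (BoundedContinuousFunction.toLp 2 μ ℂ f)
  have h2 : ∫ x, ⟪BoundedContinuousFunction.toLp 2 μ ℂ f x,
      BoundedContinuousFunction.toLp 2 μ ℂ f x⟫_ℂ ∂μ = ∫ x, ((‖f x‖ ^ 2 : ℝ) : ℂ) ∂μ := by
    refine integral_congr_ae ?_
    filter_upwards [BoundedContinuousFunction.coeFn_toLp 2 μ ℂ f] with x hx
    rw [hx, inner_self_eq_norm_sq_to_K]
    push_cast
    rfl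
  rw [h2, integral_complex_ofReal, inner_self_eq_norm_sq_to_K] at h
  exact Complex.ofReal_injective ((Complex.ofReal_pow _ _).trans h)

/-- For each vector `ξ`, the functional calculus of a commuting self-adjoint tuple, as a
representation of the bounded continuous functions on `ℝⁿ`, is isometric on `ξ` for the norm
of the `L²`-space of a finite measure. -/
theorem exists_tupleSpectralMeasure {n : ℕ} {A : Fin n → H →L[ℂ] H}
    (hsa : ∀ k, IsSelfAdjoint (A k)) (hcomm : ∀ j k, Commute (A j) (A k)) (ξ : H) :
    ∃ (μ : Measure (Fin n → ℝ)) (_ : IsFiniteMeasure μ)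
      (S : ((Fin n → ℝ) →ᵇ ℂ) →⋆ₐ[ℂ] (H →L[ℂ] H)) (φ : Fin n → (Fin n → ℝ) →ᵇ ℂ),
      (∀ f, S f ∈ tupleCStarAlgebra A) ∧ (∀ k, S (φ k) = A k) ∧
      (∀ k, ∀ᵐ x ∂μ, φ k x = (x k : ℂ)) ∧
      ∀ f, ‖S f ξ‖ = ‖BoundedContinuousFunction.toLp 2 μ ℂ f‖ := by
  obtain ⟨X, _, _, _, S, j, hS, hSA⟩ := exists_jointFunctionalCalculus hsa hcomm
  borelize X
  obtain ⟨ν, _, hν⟩ := exists_spectralMeasure S ξ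
  obtain ⟨R, hR⟩ := (isCompact_range j.continuous).isBounded.exists_norm_le
  -- The coordinates are unbounded on `ℝⁿ`, so they are truncated at a bound `R` for the range of
  -- `j`, where nothing changes. The bound is `|R|` because `R` may be negative when `X` is empty.
  let φ : Fin n → (Fin n → ℝ) →ᵇ ℂ := fun k =>
    BoundedContinuousFunction.ofNormedAddCommGroup
      (fun x => ((max (-R) (min R (x k)) : ℝ) : ℂ)) (by fun_prop) |R| fun x => by
        rw [Complex.norm_real, Real.norm_eq_abs]
        grind
  have hφ : ∀ k x, φ k (j x) = (j x k : ℂ) := fun k x => by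
    have h := (norm_le_pi_norm (j x) k).trans (hR _ ⟨x, rfl⟩)
    rw [Real.norm_eq_abs, abs_le] at h
    change ((max (-R) (min R (j x k)) : ℝ) : ℂ) = _
    rw [min_eq_right h.2, max_eq_right h.1]
  have hj : Measurable j := j.continuous.measurable
  refine ⟨ν.map j, inferInstance,
    (S.comp (j.compStarAlgHom' ℂ ℂ)).comp (BoundedContinuousFunction.toContinuousMapStarₐ ℂ),
    φ, fun f => hS _, fun k => ?_, fun k => ?_, fun f => ?_⟩
  · rw [← hSA k]
    exact congrArg S (ContinuousMap.ext (hφ k))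
  -- The pushforward is carried by the range of `j`, where the truncation is inactive.
  · rw [ae_map_iff hj.aemeasurable (measurableSet_eq_fun (φ k).continuous.measurable
      (by fun_prop))]
    exact Filter.Eventually.of_forall (hφ k)
  · rw [← sq_eq_sq₀ (norm_nonneg _) (norm_nonneg _), norm_toLp_two_sq,
      integral_map hj.aemeasurable (by fun_prop)]
    exact (hν _).symm

end FunctionalCalculus

/-! ### The `L²` model of a cyclic subspace. -/

section CyclicSubspace

variable {H : Type*} [NormedAddCommGroup H] [InnerProductSpace ℂ H] [CompleteSpace H]

/-- The closed subspace generated by `ξ` under the C⋆-algebra of a commuting self-adjoint tuple is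
unitarily equivalent to an `L²`-space, the operators becoming multiplications by coordinates. -/
theorem exists_linearIsometry_cyclic {n : ℕ} {A : Fin n → H →L[ℂ] H}
    (hsa : ∀ k, IsSelfAdjoint (A k)) (hcomm : ∀ j k, Commute (A j) (A k)) (ξ : H) :
    ∃ (μ : Measure (Fin n → ℝ)) (_ : IsFiniteMeasure μ) (W : Lp ℂ 2 μ →ₗᵢ[ℂ] H)
      (M : Fin n → Lp ℂ 2 μ → Lp ℂ 2 μ),
      (∀ k, IsMultiplicationOp μ (fun x => x k) (M k)) ∧ (∀ k f, W (M k f) = A k (W f)) ∧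
      Set.range W = closure {x : H | ∃ T ∈ tupleCStarAlgebra A, T ξ = x} := by
  obtain ⟨μ, hμ, S, φ, hS, hSA, hφ, hnorm⟩ := exists_tupleSpectralMeasure hsa hcomm ξ
  let e := BoundedContinuousFunction.toLp (E := ℂ) 2 μ ℂ
  have he : DenseRange e := BoundedContinuousFunction.toLp_denseRange ℂ μ ℂ (by simp)
  let s : ((Fin n → ℝ) →ᵇ ℂ) →ₗ[ℂ] H :=
    { toFun := fun f => S f ξ
      map_add' := fun f g => by rw [map_add, add_apply]
      map_smul' := fun c f => by rw [map_smul, smul_apply, RingHom.id_apply] }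
  let w := s.extendOfNorm (e : ((Fin n → ℝ) →ᵇ ℂ) →ₗ[ℂ] Lp ℂ 2 μ)
  have hw : ∀ f, w (e f) = S f ξ :=
    LinearMap.extendOfNorm_eq he ⟨1, fun f => by rw [one_mul]; exact (hnorm f).le⟩
  let W : Lp ℂ 2 μ →ₗᵢ[ℂ] H := ⟨w, fun f => he.induction_on (p := fun f => ‖w f‖ = ‖f‖) f
    (isClosed_eq (by fun_prop) (by fun_prop)) fun g => by rw [hw]; exact hnorm g⟩
  have hW : ∀ f, W (e f) = S f ξ := hw
  -- Multiplying by the bounded `φ k`, which equals `x k` almost everywhere, makes the operator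
  -- defined and bounded on all of `L²`.
  let M : Fin n → Lp ℂ 2 μ →L[ℂ] Lp ℂ 2 μ := fun k =>
    (ContinuousLinearMap.mul ℂ ℂ).holderL μ ∞ 2 2 (BoundedContinuousFunction.toLp ∞ μ ℂ (φ k))
  have hM : ∀ k f, ∀ᵐ x ∂μ, M k f x = φ k x * f x := fun k f => by
    filter_upwards [(ContinuousLinearMap.mul ℂ ℂ).coeFn_holder (r := 2)
      (BoundedContinuousFunction.toLp ∞ μ ℂ (φ k)) f,
      BoundedContinuousFunction.coeFn_toLp ∞ μ ℂ (φ k)] with x h1 h2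
    rw [← h2]
    exact h1
  refine ⟨μ, hμ, W, fun k => M k, fun k f => ?_, fun k f => ?_, ?_⟩
  · filter_upwards [hM k f, hφ k] with x h1 h2
    rw [h1, h2]
  · refine he.induction_on (p := fun f => W (M k f) = A k (W f)) f
      (isClosed_eq (by fun_prop) (by fun_prop)) fun g => ?_
    have : M k (e g) = e (φ k * g) := by
      refine Lp.ext ?_
      filter_upwards [hM k (e g), BoundedContinuousFunction.coeFn_toLp 2 μ ℂ g,
        BoundedContinuousFunction.coeFn_toLp 2 μ ℂ (φ k * g)] with x h1 h2 h3
      rw [h1, h2, h3]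
      rfl
    rw [this, hW, hW, map_mul, hSA, mul_apply_eq_comp]
  · have hcl : IsClosed (Set.range W) := W.isometry.isClosedEmbedding.isClosed_range
    refine Set.Subset.antisymm ?_ (closure_minimal ?_ hcl)
    · refine Set.range_subset_iff.2 fun f => he.induction_on
        (p := fun f => W f ∈ closure {x : H | ∃ T ∈ tupleCStarAlgebra A, T ξ = x}) f
        (isClosed_closure.preimage W.continuous) fun g => ?_
      exact subset_closure ⟨S g, hS g, (hW g).symm⟩
    · rintro _ ⟨T, hT, rfl⟩
      -- The condition `T ξ ∈ range W` is closed in `T`, so it suffices to check it on the algebraic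
      -- star subalgebra, which lies in the range of `S`.
      have hclosed : IsClosed {T : H →L[ℂ] H | T ξ ∈ Set.range W} :=
        hcl.preimage (by fun_prop : Continuous fun T : H →L[ℂ] H => T ξ)
      refine closure_minimal (fun B hB => ?_) hclosed hT
      have hle : StarAlgebra.adjoin ℂ (Set.range A) ≤ S.range := by
        refine StarAlgebra.adjoin_le ?_
        rintro _ ⟨k, rfl⟩
        exact ⟨φ k, hSA k⟩
      obtain ⟨f, rfl⟩ := hle hB
      exact ⟨e f, hW f⟩

end CyclicSubspace

/-! ### Orthogonal decomposition into cyclic subspaces. -/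

section Decomposition

variable {H : Type*} [NormedAddCommGroup H] [InnerProductSpace ℂ H] [CompleteSpace H]
  {n : ℕ} (A : Fin n → H →L[ℂ] H)

/-- The closed subspace generated by `ξ` under the C⋆-algebra generated by the tuple `A`. -/
noncomputable def tupleCyclicSubspace (ξ : H) : Submodule ℂ H :=
  ((tupleCStarAlgebra A).toSubalgebra.toSubmodule.map
    (ContinuousLinearMap.apply ℂ H ξ : (H →L[ℂ] H) →ₗ[ℂ] H)).topologicalClosure

theorem coe_tupleCyclicSubspace (ξ : H) :
    (tupleCyclicSubspace A ξ : Set H) = closure {x : H | ∃ T ∈ tupleCStarAlgebra A, T ξ = x} :=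
  rfl

theorem isClosed_tupleCyclicSubspace (ξ : H) : IsClosed (tupleCyclicSubspace A ξ : Set H) :=
  isClosed_closure

theorem self_mem_tupleCyclicSubspace (ξ : H) : ξ ∈ tupleCyclicSubspace A ξ :=
  subset_closure ⟨1, one_mem (tupleCStarAlgebra A), rfl⟩

variable {A}

theorem tupleCyclicSubspace_le {ξ : H} {K : Submodule ℂ H} (hK : IsClosed (K : Set H))
    (h : ∀ T ∈ tupleCStarAlgebra A, T ξ ∈ K) : tupleCyclicSubspace A ξ ≤ K := by
  refine Submodule.topologicalClosure_minimal _ ?_ hK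
  rintro _ ⟨T, hT, rfl⟩
  exact h T hT

theorem map_mem_tupleCyclicSubspace {T : H →L[ℂ] H} (hT : T ∈ tupleCStarAlgebra A) {ξ x : H}
    (hx : x ∈ tupleCyclicSubspace A ξ) : T x ∈ tupleCyclicSubspace A ξ := by
  have : tupleCyclicSubspace A ξ ≤
      (tupleCyclicSubspace A ξ).comap (T : H →ₗ[ℂ] H) :=
    tupleCyclicSubspace_le ((isClosed_tupleCyclicSubspace A ξ).preimage T.continuous)
      fun S hS => subset_closure ⟨T * S, (tupleCStarAlgebra A).mul_mem hT hS, rfl⟩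
  exact this hx

/-- The algebra is closed under adjoints, so `T` can be moved to the other side of the inner
product. -/
theorem map_mem_orthogonal_tupleCyclicSubspace {T : H →L[ℂ] H} (hT : T ∈ tupleCStarAlgebra A)
    {ξ x : H} (hx : x ∈ (tupleCyclicSubspace A ξ)ᗮ) : T x ∈ (tupleCyclicSubspace A ξ)ᗮ := by
  rw [Submodule.mem_orthogonal] at hx ⊢
  intro y hy
  rw [← ContinuousLinearMap.adjoint_inner_left]
  exact hx _ (map_mem_tupleCyclicSubspace (star_mem hT) hy)

/-- The orthogonal complement is closed and invariant, hence contains the whole cyclic subspace of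
each of its vectors. -/
theorem isOrtho_tupleCyclicSubspace {ξ η : H} (h : η ∈ (tupleCyclicSubspace A ξ)ᗮ) :
    tupleCyclicSubspace A ξ ⟂ tupleCyclicSubspace A η :=
  Submodule.isOrtho_comm.1 (tupleCyclicSubspace_le (Submodule.isClosed_orthogonal _)
    fun _ hT => map_mem_orthogonal_tupleCyclicSubspace hT h)

theorem tupleCyclicSubspace_ne_bot {ξ : H} (h : ξ ≠ 0) : tupleCyclicSubspace A ξ ≠ ⊥ :=
  fun h0 => h ((Submodule.mem_bot ℂ).1 (h0 ▸ self_mem_tupleCyclicSubspace A ξ))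

variable (A)

theorem tupleCyclicSubspace_zero : tupleCyclicSubspace A 0 = ⊥ :=
  le_bot_iff.1 (tupleCyclicSubspace_le (by simp) (by simp))

/-- A separable Hilbert space is the closed span of a sequence of pairwise orthogonal cyclic
subspaces. -/
theorem exists_orthogonal_tupleCyclicSubspaces [TopologicalSpace.SeparableSpace H] :
    ∃ ξ : ℕ → H,
      Pairwise (fun i j => tupleCyclicSubspace A (ξ i) ⟂ tupleCyclicSubspace A (ξ j)) ∧
      (⨆ m, tupleCyclicSubspace A (ξ m)).topologicalClosure = ⊤ := by
  let x := TopologicalSpace.denseSeq H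
  -- `L m` is the sum of the cyclic subspaces chosen before stage `m`; the next generator is the
  -- component of `x m` orthogonal to it. Only `(L m)ᗮ` is projected onto, so `L m` need not be
  -- closed.
  let L : ℕ → Submodule ℂ H := fun m => Nat.rec (motive := fun _ => Submodule ℂ H) ⊥
    (fun i K => K ⊔ tupleCyclicSubspace A (Kᗮ.starProjection (x i))) m
  let ξ : ℕ → H := fun m => (L m)ᗮ.starProjection (x m)
  have hL : ∀ m, L (m + 1) = L m ⊔ tupleCyclicSubspace A (ξ m) := fun _ => rfl
  have hmono : Monotone L := monotone_nat_of_le_succ fun m => hL m ▸ le_sup_left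
  have hortho : ∀ i j, i < j → tupleCyclicSubspace A (ξ i) ⟂ tupleCyclicSubspace A (ξ j) := by
    intro i j hij
    refine isOrtho_tupleCyclicSubspace ?_
    have hle : tupleCyclicSubspace A (ξ i) ≤ L j :=
      (hL i ▸ le_sup_right : _ ≤ L (i + 1)).trans (hmono hij)
    exact Submodule.orthogonal_le hle (Submodule.starProjection_apply_mem _ _)
  refine ⟨ξ, fun i j hij => ?_, ?_⟩
  · rcases hij.lt_or_gt with h | h
    · exact hortho i j h
    · exact (hortho j i h).symm
  · rw [Submodule.topologicalClosure_eq_top_iff, Submodule.eq_bot_iff]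
    intro y hy
    have hLle : ∀ m, L m ≤ ⨆ m, tupleCyclicSubspace A (ξ m) := by
      intro m
      induction m with
      | zero => exact bot_le
      | succ m ih => exact sup_le ih (le_iSup (fun m => tupleCyclicSubspace A (ξ m)) m)
    -- As `y ∈ (L m)ᗮ`, `x m` may be replaced by its projection `ξ m`, to which `y` is orthogonal.
    have hx : ∀ m, ⟪x m, y⟫_ℂ = 0 := fun m => by
      have hyL : y ∈ (L m)ᗮ := Submodule.orthogonal_le (hLle m) hy
      rw [← Submodule.starProjection_eq_self_iff.2 hyL, ← Submodule.inner_starProjection_left_eq_right]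
      exact (Submodule.mem_orthogonal _ _).1 hy _
        (Submodule.mem_iSup_of_mem m (self_mem_tupleCyclicSubspace A (ξ m)))
    exact (TopologicalSpace.denseRange_denseSeq H).eq_zero_of_inner_left ℂ
      fun m => inner_eq_zero_symm.1 (hx m)

end Decomposition

/-! ### Components in a Hilbert sum. -/

section HilbertSum

variable {ι E : Type*} {G : ι → Type*} [NormedAddCommGroup E] [InnerProductSpace ℂ E]
  [∀ i, NormedAddCommGroup (G i)] [∀ i, InnerProductSpace ℂ (G i)] {W : ∀ i, G i →ₗᵢ[ℂ] E}

theorem OrthogonalFamily.inner_of_hasSum (hW : OrthogonalFamily ℂ G W) {f : ∀ i, G i} {v : E}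
    (h : HasSum (fun i => W i (f i)) v) (i : ι) (g : G i) : ⟪W i g, v⟫_ℂ = ⟪g, f i⟫_ℂ := by
  have h1 := h.mapL (innerSL ℂ (W i g))
  refine h1.unique ?_
  rw [← (W i).inner_map_map]
  exact hasSum_single i fun j hj => hW hj.symm g (f j)

/-- A symmetric operator which intertwines the isometries of a Hilbert sum with operators `M i`
acts on the sum componentwise. -/
theorem OrthogonalFamily.component_apply [CompleteSpace E] (hW : OrthogonalFamily ℂ G W)
    {T : E →L[ℂ] E} (hT : IsSelfAdjoint T) {M : ∀ i, G i → G i}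
    (hM : ∀ i g, W i (M i g) = T (W i g)) {f g : ∀ i, G i} {v : E}
    (hf : HasSum (fun i => W i (f i)) v) (hg : HasSum (fun i => W i (g i)) (T v)) (i : ι) :
    g i = M i (f i) := by
  refine ext_inner_left ℂ fun h => ?_
  have hsymm : ∀ x y : E, ⟪T x, y⟫_ℂ = ⟪x, T y⟫_ℂ := hT.isSymmetric
  -- Symmetry moves `T` onto the test vector in summand `i`, where it is `M i`, and then back.
  -- Neither linearity of `M i` nor summability of the family `W i (M i (f i))` is used.
  rw [← hW.inner_of_hasSum hg i h, ← hsymm, ← hM, hW.inner_of_hasSum hf, ← (W i).inner_map_map,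
    hM, hsymm, ← hM, (W i).inner_map_map]

end HilbertSum

/-! ### `L²` of a disjoint union of measures. -/

section DisjointUnion

variable {ι X : Type*} [MeasurableSpace ι] [MeasurableSingletonClass ι] [MeasurableSpace X]
  (μ : ι → Measure X)

theorem ae_disjointUnionMeasure_iff [Countable ι] {p : ι × X → Prop} :
    (∀ᵐ y ∂disjointUnionMeasure μ, p y) ↔ ∀ i, ∀ᵐ x ∂μ i, p (i, x) := by
  rw [disjointUnionMeasure, Measure.ae_sum_iff]
  exact forall_congr' fun i => (measurableEmbedding_prodMk_left i).ae_map_iff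

/-- Distinct slices are disjoint, so one summand survives. Integrability, null sets and integrals
are transferred to slices through this identity. -/
theorem restrict_disjointUnionMeasure (i : ι) :
    (disjointUnionMeasure μ).restrict (Set.range (Prod.mk i)) = (μ i).map (Prod.mk i) := by
  have hm : ∀ j : ι, MeasurableSet (Set.range (Prod.mk j : X → ι × X)) :=
    fun j => (measurableEmbedding_prodMk_left j).measurableSet_range
  ext s hs
  rw [Measure.restrict_apply hs, disjointUnionMeasure, Measure.sum_apply _ (hs.inter (hm i)),
    tsum_eq_single i]
  · rw [Measure.map_apply (by fun_prop) (hs.inter (hm i)), Measure.map_apply (by fun_prop) hs]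
    congr 1
    ext x
    simp
  · intro j hj
    rw [Measure.map_apply (by fun_prop) (hs.inter (hm i))]
    convert measure_empty (μ := μ j)
    ext x
    simp [hj.symm]

variable {μ}

theorem memLp_indicator_snd {i : ι} {f : X → ℂ} (hf : MemLp f 2 (μ i)) :
    MemLp ((Set.range (Prod.mk i)).indicator (f ∘ Prod.snd)) 2 (disjointUnionMeasure μ) := by
  have he := measurableEmbedding_prodMk_left (β := X) i
  rw [memLp_indicator_iff_restrict he.measurableSet_range, restrict_disjointUnionMeasure,
    he.memLp_map_measure_iff]
  exact hf

theorem memLp_slice {f : ι × X → ℂ} (hf : MemLp f 2 (disjointUnionMeasure μ)) (i : ι) :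
    MemLp (fun x => f (i, x)) 2 (μ i) := by
  have he := measurableEmbedding_prodMk_left (β := X) i
  have := hf.restrict (Set.range (Prod.mk i))
  rwa [restrict_disjointUnionMeasure, he.memLp_map_measure_iff] at this

theorem coeFn_slice_ae {f g : ι × X → ℂ} (h : f =ᵐ[disjointUnionMeasure μ] g) (i : ι) :
    (fun x => f (i, x)) =ᵐ[μ i] fun x => g (i, x) := by
  have he := measurableEmbedding_prodMk_left (β := X) i
  have := ae_restrict_of_ae (s := Set.range (Prod.mk i)) h
  rwa [restrict_disjointUnionMeasure, he.ae_map_iff] at this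

theorem integral_indicator_slice {E : Type*} [NormedAddCommGroup E] [NormedSpace ℝ E] (i : ι)
    (f : ι × X → E) :
    ∫ y, (Set.range (Prod.mk i)).indicator f y ∂disjointUnionMeasure μ = ∫ x, f (i, x) ∂μ i := by
  have he := measurableEmbedding_prodMk_left (β := X) i
  rw [integral_indicator he.measurableSet_range, restrict_disjointUnionMeasure, he.integral_map]

/-- Extension by zero of a square-integrable function on the slice `{i} × X`. -/
noncomputable def sliceExtension {i : ι} (f : Lp ℂ 2 (μ i)) : Lp ℂ 2 (disjointUnionMeasure μ) :=
  (memLp_indicator_snd (Lp.memLp f)).toLp _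

theorem coeFn_sliceExtension {i : ι} (f : Lp ℂ 2 (μ i)) :
    ∀ᵐ x ∂μ i, sliceExtension f (i, x) = f x := by
  filter_upwards [coeFn_slice_ae (memLp_indicator_snd (Lp.memLp f)).coeFn_toLp i] with x hx
  exact hx.trans (Set.indicator_of_mem (Set.mem_range_self x) _)

theorem coeFn_sliceExtension_of_ne {i j : ι} (hij : j ≠ i) (f : Lp ℂ 2 (μ i)) :
    ∀ᵐ x ∂μ j, sliceExtension f (j, x) = 0 := by
  filter_upwards [coeFn_slice_ae (memLp_indicator_snd (Lp.memLp f)).coeFn_toLp j] with x hx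
  refine hx.trans (Set.indicator_of_notMem ?_ _)
  rintro ⟨y, hy⟩
  exact hij (congrArg Prod.fst hy).symm

theorem ext_slice [Countable ι] {f g : Lp ℂ 2 (disjointUnionMeasure μ)}
    (h : ∀ i, ∀ᵐ x ∂μ i, f (i, x) = g (i, x)) : f = g :=
  Lp.ext ((ae_disjointUnionMeasure_iff μ).2 h)

theorem inner_sliceExtension {i : ι} (f : Lp ℂ 2 (μ i)) (g : Lp ℂ 2 (disjointUnionMeasure μ)) :
    ⟪sliceExtension f, g⟫_ℂ = ∫ x, ⟪f x, g (i, x)⟫_ℂ ∂μ i := by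
  rw [L2.inner_def, ← integral_indicator_slice (μ := μ) i fun y => ⟪f y.2, g y⟫_ℂ]
  refine integral_congr_ae ?_
  filter_upwards [(memLp_indicator_snd (Lp.memLp f)).coeFn_toLp] with y hy
  change ⟪(memLp_indicator_snd (Lp.memLp f)).toLp _ y, g y⟫_ℂ = _
  rw [hy]
  by_cases h : y ∈ Set.range (Prod.mk i : X → ι × X)
  · rw [Set.indicator_of_mem h, Set.indicator_of_mem h]
    rfl
  · rw [Set.indicator_of_notMem h, Set.indicator_of_notMem h, inner_zero_left]

variable (μ)

/-- Extension by zero from a slice, as a linear isometry of `L²`-spaces. -/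
noncomputable def sliceExtensionₗᵢ [Countable ι] (i : ι) :
    Lp ℂ 2 (μ i) →ₗᵢ[ℂ] Lp ℂ 2 (disjointUnionMeasure μ) :=
  LinearMap.isometryOfInner
    { toFun := sliceExtension
      map_add' := fun f g => by
        refine ext_slice fun j => ?_
        have hadd := coeFn_slice_ae (Lp.coeFn_add (sliceExtension f) (sliceExtension g)) j
        by_cases hij : j = i
        · subst hij
          filter_upwards [hadd, Lp.coeFn_add f g, coeFn_sliceExtension f, coeFn_sliceExtension g,
            coeFn_sliceExtension (f + g)] with x h h1 h2 h3 h4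
          rw [h, h4, h1, Pi.add_apply, Pi.add_apply, h2, h3]
        · filter_upwards [hadd, coeFn_sliceExtension_of_ne hij f,
            coeFn_sliceExtension_of_ne hij g, coeFn_sliceExtension_of_ne hij (f + g)]
            with x h h2 h3 h4
          rw [h, h4, Pi.add_apply, h2, h3, add_zero]
      map_smul' := fun c f => by
        refine ext_slice fun j => ?_
        have hsmul := coeFn_slice_ae (Lp.coeFn_smul c (sliceExtension f)) j
        by_cases hij : j = i
        · subst hij
          filter_upwards [hsmul, Lp.coeFn_smul c f, coeFn_sliceExtension f,
            coeFn_sliceExtension (c • f)] with x h h1 h2 h4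
          rw [RingHom.id_apply, h, h4, h1, Pi.smul_apply, Pi.smul_apply, h2]
        · filter_upwards [hsmul, coeFn_sliceExtension_of_ne hij f,
            coeFn_sliceExtension_of_ne hij (c • f)] with x h h2 h4
          rw [RingHom.id_apply, h, h4, Pi.smul_apply, h2, smul_zero] }
    fun f g => by
      refine (inner_sliceExtension f (sliceExtension g)).trans ?_
      rw [L2.inner_def]
      refine integral_congr_ae ?_
      filter_upwards [coeFn_sliceExtension g] with x hx
      rw [hx]

variable {μ}

/-- Slicing is the adjoint of extension by zero; this identifies the components in the Hilbert sum
with slices. -/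
theorem inner_sliceExtensionₗᵢ [Countable ι] {i : ι} (f : Lp ℂ 2 (μ i))
    (g : Lp ℂ 2 (disjointUnionMeasure μ)) :
    ⟪sliceExtensionₗᵢ μ i f, g⟫_ℂ = ⟪f, (memLp_slice (Lp.memLp g) i).toLp _⟫_ℂ := by
  refine (inner_sliceExtension f g).trans ?_
  rw [L2.inner_def]
  refine integral_congr_ae ?_
  filter_upwards [(memLp_slice (Lp.memLp g) i).coeFn_toLp] with x hx
  rw [hx]

variable (μ)

theorem isHilbertSum_sliceExtension [Countable ι] :
    IsHilbertSum ℂ (fun i => Lp ℂ 2 (μ i)) (sliceExtensionₗᵢ μ) := by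
  refine IsHilbertSum.mk (fun i j hij f g => ?_) (top_le_iff.2 ?_)
  · refine (inner_sliceExtension f (sliceExtension g)).trans (integral_eq_zero_of_ae ?_)
    filter_upwards [coeFn_sliceExtension_of_ne hij g] with x hx
    rw [hx, inner_zero_right, Pi.zero_apply]
  · rw [Submodule.topologicalClosure_eq_top_iff, Submodule.eq_bot_iff]
    intro g hg
    -- Pairing `g` with the extension of its own slice gives the squared norm of that slice.
    have hslice : ∀ i, (memLp_slice (Lp.memLp g) i).toLp _ = 0 := fun i => by
      rw [← inner_self_eq_zero (𝕜 := ℂ), ← inner_sliceExtensionₗᵢ]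
      exact (Submodule.mem_orthogonal _ _).1 hg _ (Submodule.mem_iSup_of_mem i ⟨_, rfl⟩)
    refine ext_slice fun i => ?_
    filter_upwards [(memLp_slice (Lp.memLp g) i).coeFn_toLp, Lp.coeFn_zero ℂ 2 (μ i),
      coeFn_slice_ae (Lp.coeFn_zero ℂ 2 (disjointUnionMeasure μ)) i] with x h1 h2 h3
    rw [h3, ← h1, hslice i, h2]
    rfl

/-- The natural identification of the Hilbert sum of a countable family of `L²`-spaces with the
`L²`-space of the disjoint union of the measures. -/
theorem exists_lp_equiv_disjointUnion [Countable ι] :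
    ∃ Φ : lp (fun i => Lp ℂ 2 (μ i)) 2 ≃ₗᵢ[ℂ] Lp ℂ 2 (disjointUnionMeasure μ),
      ∀ f i, ∀ᵐ x ∂μ i, Φ f (i, x) = f i x := by
  have hsum := isHilbertSum_sliceExtension μ
  refine ⟨hsum.linearIsometryEquiv.symm, fun f i => ?_⟩
  let Φf := hsum.linearIsometryEquiv.symm f
  have h : (memLp_slice (Lp.memLp Φf) i).toLp _ = f i := by
    refine ext_inner_left ℂ fun h => ?_
    rw [← inner_sliceExtensionₗᵢ]
    exact hsum.OrthogonalFamily.inner_of_hasSum (hsum.hasSum_linearIsometryEquiv_symm f) i h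
  filter_upwards [(memLp_slice (Lp.memLp Φf) i).coeFn_toLp] with x hx
  rw [← h, hx]

end DisjointUnion

/-! ### The spectral representation. -/

section SpectralRepresentation

variable {H : Type*} [NormedAddCommGroup H] [InnerProductSpace ℂ H] [CompleteSpace H]

/-- The restriction of a commuting self-adjoint tuple to a cyclic subspace is unitarily equivalent to
the tuple of multiplications by the coordinates on an `L²`-space of a finite measure on `ℝⁿ`. -/
theorem exists_linearIsometryEquiv_cyclic {n : ℕ} {A : Fin n → H →L[ℂ] H}
    (hsa : ∀ k, IsSelfAdjoint (A k)) (hcomm : ∀ j k, Commute (A j) (A k)) (ξ : H) :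
    ∃ (μ : Measure (Fin n → ℝ)) (_ : IsFiniteMeasure μ)
      (U : Lp ℂ 2 μ ≃ₗᵢ[ℂ] tupleCyclicSubspace A ξ) (M : Fin n → Lp ℂ 2 μ → Lp ℂ 2 μ),
      (∀ k, IsMultiplicationOp μ (fun x => x k) (M k)) ∧
        ∀ k f, (U (M k f) : H) = A k (U f) := by
  obtain ⟨μ, hμ, W, M, hM, hWM, hrange⟩ := exists_linearIsometry_cyclic hsa hcomm ξ
  have hK : W.toLinearMap.range = tupleCyclicSubspace A ξ := SetLike.coe_injective hrange
  rw [← hK]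
  exact ⟨μ, hμ, W.equivRange, M, hM, hWM⟩

theorem IsJointCyclicVector.tupleCyclicSubspace_eq_top {n : ℕ} {A : Fin n → H →L[ℂ] H} {ξ : H}
    (h : IsJointCyclicVector A ξ) : tupleCyclicSubspace A ξ = ⊤ := by
  refine SetLike.coe_injective (Dense.closure_eq (h.mono ?_))
  rintro _ ⟨T, hT, rfl⟩
  have hle : Algebra.adjoin ℂ (Set.range A) ≤ (tupleCStarAlgebra A).toSubalgebra :=
    Algebra.adjoin_le (by rintro _ ⟨k, rfl⟩; exact mem_tupleCStarAlgebra A k)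
  exact ⟨T, hle hT, rfl⟩

end SpectralRepresentation

theorem theorem2p2 {H : Type*} [NormedAddCommGroup H] [InnerProductSpace ℂ H] [CompleteSpace H]
    [TopologicalSpace.SeparableSpace H] {n : ℕ} (A : Fin n → H →L[ℂ] H)
    (hsa : ∀ k, IsSelfAdjoint (A k)) (hcomm : ∀ j k, Commute (A j) (A k)) :
    -- the cyclic case
    ((∃ ξ : H, IsJointCyclicVector A ξ) →
      ∃ μ : Measure (Fin n → ℝ), IsFiniteMeasure μ ∧
        ∃ U : Lp ℂ 2 μ ≃ₗᵢ[ℂ] H, ∀ k : Fin n,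
          IsMultiplicationOp μ (fun x => x k) (fun f => U.symm (A k (U f)))) ∧
    -- the general case: decomposition into countably many cyclic subspaces
    (∃ (I : Set ℕ) (K : I → Submodule ℂ H) (ξ : I → H) (μ : I → Measure (Fin n → ℝ))
        (U : ∀ m, Lp ℂ 2 (μ m) ≃ₗᵢ[ℂ] K m)
        (hinv : ∀ m k, ∀ x ∈ K m, A k x ∈ K m)
        (V : lp (fun m => Lp ℂ 2 (μ m)) 2 ≃ₗᵢ[ℂ] H)
        (Φ : lp (fun m => Lp ℂ 2 (μ m)) 2 ≃ₗᵢ[ℂ] Lp ℂ 2 (disjointUnionMeasure μ)),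
      -- `H` is the Hilbert sum of the nonzero closed subspaces `K m`
      (∀ m, IsClosed (K m : Set H) ∧ K m ≠ ⊥) ∧
      OrthogonalFamily ℂ (fun m => K m) (fun m => (K m).subtypeₗᵢ) ∧
      (⨆ m, K m).topologicalClosure = ⊤ ∧
      -- each `K m` reduces the generated C⋆-algebra and has the cyclic vector `ξ m`
      (∀ m, ∀ T ∈ tupleCStarAlgebra A, IsReducingFor (K m) T) ∧
      (∀ m, ξ m ∈ K m ∧ closure {x : H | ∃ T ∈ tupleCStarAlgebra A, T (ξ m) = x} = K m) ∧
      -- `U m` turns the restrictions to `K m` into multiplication by the coordinates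
      (∀ m, IsFiniteMeasure (μ m)) ∧
      (∀ m k, IsMultiplicationOp (μ m) (fun x => x k)
        (fun f => (U m).symm ⟨A k (U m f), hinv m k _ (U m f).2⟩)) ∧
      -- `V` is the direct sum of the `U m` and turns each `A k` into the direct sum
      -- of the multiplications by the coordinate
      (∀ f, HasSum (fun m => (U m (f m) : H)) (V f)) ∧
      (∀ k f m, ∀ᵐ x ∂(μ m),
        (V.symm (A k (V f)) m : (Fin n → ℝ) → ℂ) x = (x k : ℂ) * (f m : (Fin n → ℝ) → ℂ) x) ∧
      -- `Φ` is the natural identification with a single `L²` space, and carries this over to it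
      (∀ f m, ∀ᵐ x ∂(μ m),
        (Φ f : I × (Fin n → ℝ) → ℂ) (m, x) = (f m : (Fin n → ℝ) → ℂ) x) ∧
      (∀ k, IsMultiplicationOp (disjointUnionMeasure μ) (fun y => y.2 k)
        (fun f => Φ (V.symm (A k (V (Φ.symm f))))))) := by
  have hcyc := exists_linearIsometryEquiv_cyclic hsa hcomm
  refine ⟨?_, ?_⟩
  · rintro ⟨ξ, hξ⟩
    obtain ⟨μ, hμ, U, M, hM, hUM⟩ := hcyc ξ
    let e : tupleCyclicSubspace A ξ ≃ₗᵢ[ℂ] H :=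
      LinearIsometryEquiv.ofTop H _ hξ.tupleCyclicSubspace_eq_top
    refine ⟨μ, hμ, U.trans e, fun k f => ?_⟩
    have h : (U.trans e).symm (A k (U.trans e f)) = M k f := by
      rw [LinearIsometryEquiv.symm_apply_eq]
      exact (hUM k f).symm
    filter_upwards [hM k f] with x hx
    rw [h, hx]
  · obtain ⟨ξ, hortho, htop⟩ := exists_orthogonal_tupleCyclicSubspaces A
    choose μ hμ U M hM hUM using hcyc
    -- The orthogonalization may produce zero vectors. Their cyclic subspaces are trivial, so
    -- dropping them makes every `K m` nonzero without changing the span.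
    let I : Set ℕ := {m | ξ m ≠ 0}
    let K : I → Submodule ℂ H := fun m => tupleCyclicSubspace A (ξ m)
    let W : ∀ m : I, Lp ℂ 2 (μ (ξ m)) →ₗᵢ[ℂ] H := fun m =>
      (K m).subtypeₗᵢ.comp (U (ξ m)).toLinearIsometry
    have hcl : ∀ m, IsClosed (K m : Set H) := fun m => isClosed_tupleCyclicSubspace A _
    have hKortho : OrthogonalFamily ℂ (fun m => K m) (fun m => (K m).subtypeₗᵢ) :=
      OrthogonalFamily.of_pairwise fun i j hij => hortho (Subtype.coe_injective.ne hij)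
    have hKtop : (⨆ m, K m).topologicalClosure = ⊤ := by
      rw [← htop]
      congr 1
      refine le_antisymm (iSup_le fun m => le_iSup (fun m => tupleCyclicSubspace A (ξ m)) m)
        (iSup_le fun m => ?_)
      by_cases hm : ξ m = 0
      · rw [hm, tupleCyclicSubspace_zero]
        exact bot_le
      · exact le_iSup K ⟨m, hm⟩
    have hWortho : OrthogonalFamily ℂ (fun m : I => Lp ℂ 2 (μ (ξ m))) W :=
      fun i j hij f g => hKortho hij (U _ f) (U _ g)
    have hWrange : ∀ m, (W m).toLinearMap.range = K m := fun m => by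
      ext x
      exact ⟨fun ⟨f, hf⟩ => hf ▸ (U (ξ m) f).2,
        fun hx => ⟨(U (ξ m)).symm ⟨x, hx⟩, by simp [W]⟩⟩
    have hsum : IsHilbertSum ℂ (fun m : I => Lp ℂ 2 (μ (ξ m))) W :=
      IsHilbertSum.mk hWortho (by simp only [hWrange]; exact hKtop.ge)
    obtain ⟨Φ, hΦ⟩ := exists_lp_equiv_disjointUnion fun m : I => μ (ξ m)
    let V := hsum.linearIsometryEquiv.symm
    have hV : ∀ f, HasSum (fun m => W m (f m)) (V f) := hsum.hasSum_linearIsometryEquiv_symm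
    have hinv : ∀ m k, ∀ x ∈ K m, A k x ∈ K m := fun m k x hx =>
      map_mem_tupleCyclicSubspace (mem_tupleCStarAlgebra A k) hx
    -- Self-adjointness of `A k` gives the componentwise action, the `U (ξ m)` intertwining it with
    -- `M (ξ m) k`.
    have hcomp : ∀ k f m, V.symm (A k (V f)) m = M (ξ m) k (f m) := fun k f m =>
      hWortho.component_apply (hsa k) (M := fun m : I => M (ξ m) k) (fun m g => hUM (ξ m) k g)
        (hV f) (by
          have h := hV (V.symm (A k (V f)))
          rwa [V.apply_symm_apply] at h) m
    have hVmul : ∀ k f m, ∀ᵐ x ∂(μ (ξ m)), (V.symm (A k (V f)) m : (Fin n → ℝ) → ℂ) x =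
        (x k : ℂ) * (f m : (Fin n → ℝ) → ℂ) x := fun k f m => by
      rw [hcomp]
      exact hM (ξ m) k (f m)
    refine ⟨I, K, fun m => ξ m, fun m => μ (ξ m), fun m => U (ξ m), hinv, V, Φ,
      fun m => ⟨hcl m, tupleCyclicSubspace_ne_bot m.2⟩, hKortho, hKtop,
      fun m T hT => ⟨fun x => map_mem_tupleCyclicSubspace hT,
        fun x => map_mem_orthogonal_tupleCyclicSubspace hT⟩,
      fun m => ⟨self_mem_tupleCyclicSubspace A _, (coe_tupleCyclicSubspace A _).symm⟩,
      fun m => hμ _, fun m k f => ?_, hV, hVmul, hΦ, fun k f => ?_⟩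
    · have h : (U (ξ m)).symm ⟨A k (U (ξ m) f), hinv m k _ (U (ξ m) f).2⟩ = M (ξ m) k f := by
        rw [LinearIsometryEquiv.symm_apply_eq]
        exact Subtype.ext (hUM (ξ m) k f).symm
      filter_upwards [hM (ξ m) k f] with x hx
      rw [h, hx]
    · refine (ae_disjointUnionMeasure_iff _).2 fun m => ?_
      have hf := hΦ (Φ.symm f) m
      rw [Φ.apply_symm_apply] at hf
      filter_upwards [hΦ (V.symm (A k (V (Φ.symm f)))) m, hVmul k (Φ.symm f) m, hf] with x h1 h2 h3
      rw [h1, h2, h3]
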